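/- \textbf{Setting.} Let $n,p,K$ be integers with $n\ge1$ and $1\le K\le p$, let $X\in\mathbb R^{n\times p}$ be a deterministic design matrix, $\beta\in\mathbb R^p$, $\tau>0$, and let $Y=X\beta+\varepsilon$ with $\varepsilon\sim\mathcal N_n(0,\tau^2I_n)$. Put $$\Sigma=\tfrac1nX^TX,\qquad \hat\sigma=\tfrac1nX^TY,\qquad \sigma=\mathbb E(\hat\sigma)=\tfrac1nX^TX\beta,$$ $$G=(\sigma,\Sigma\sigma,\dots,\Sigma^{K-1}\sigma),\quad \Theta=G^T\Sigma G=(\sigma^T\Sigma^{i+j-1}\sigma)_{1\le i,j\le K},\qquad \hat G=(\hat\sigma,\Sigma\hat\sigma,\dots,\Sigma^{K-1}\hat\sigma),\quad \hat\Theta=\hat G^T\Sigma\hat G,$$ $D=\mathrm{diag}(\Theta)$ and $R=D^{-1/2}\Theta D^{-1/2}$, and let $[G]$ denote the span of the columns of $G$. Write $\rho(A)$ and $\rho_{\min}(A)$ for the largest and the smallest eigenvalue of a symmetric matrix $A$, $\mathrm{Tr}$ for the trace and $\|\cdot\|$ for the $\ell^2$ norm. Put $\Lambda=\Theta^{-1}G^T\sigma$,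 $\tilde\Lambda=D^{1/2}\Lambda$ and $\bar\Lambda=D^{-1}G^T\sigma$. For $\delta\in(0,1)$ let $x_\delta=\ln(6K/\delta)$, $$C_\delta=\max\bigl(1+2x_\delta+2\sqrt{x_\delta},\,2\sqrt{2x_\delta}\bigr),\qquad c_\delta=16\,C_\delta .$$ For $\alpha=(\alpha_1,\dots,\alpha_K)$ with positive entries, the ridge PLS estimator is $\hat\beta_{K,\alpha}=\hat G\bigl(\hat\Theta+\mathrm{diag}(\alpha_1,\dots,\alpha_K)\bigr)^{-1}\hat G^T\hat\sigma$. \textbf{Theorem.} Let $\delta\in(0,1)$, suppose that $\rho_{\min}(R)>0$ (in particular $D$ and $\Theta$ are invertible), and set $$\alpha_i=c_\delta K\frac{\tau^2}{n}\rho(\Sigma)^i\,\mathrm{Tr}(\Sigma^i),\qquad i=1,\dots,K.$$ Then, with probability at least $1-\delta$, \begin{align*} \frac1n\|X\hat\beta_{K,\alpha}-X\beta\|^2 &\le\frac2n\inf_{v\in[G]}\|X(\beta-v)\|^2 +\mathcal C^{(1)}_{\delta,R}\,\frac{\tau^2}{n}\Bigl(\sum_{i=1}^K\sqrt{\mathrm{Tr}(\Sigma^{2i})}\,|\Lambda_i|\Bigr)^2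 +\mathcal C^{(2)}_{\delta,R}\,\|\tilde\Lambda\|^2\,\frac{\tau^2}{n}\sum_{j=1}^K\frac{\rho(\Sigma)^{2j}}{\sigma^T\Sigma^{2j-1}\sigma}\\ &\quad+\mathcal C^{(3)}_{\delta,R}\,\frac{\tau^2}{n}\Bigl(\frac1{Kc_\delta}\sum_{i=1}^K\bar\Lambda_i\,\mathrm{Tr}(\Sigma^i)+\sum_{i=1}^K\bar\Lambda_i\,\rho(\Sigma)^i\Bigr) +\mathcal C^{(4)}_{\delta,R}\,\frac{\tau^2}{n}\,K\,c_\delta\sum_{i=1}^K\rho(\Sigma)^i\,\mathrm{Tr}(\Sigma^i)\,\Lambda_i^2, \end{align*} where the positive constants $\mathcal C^{(1)}_{\delta,R},\dots,\mathcal C^{(4)}_{\delta,R}$ depend only on $\delta$ and on the $K\times K$ matrix $R$ (hence on its size $K$), and not otherwise on $n,p,X,\beta,\tau$. -/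

import Mathlib

open MeasureTheory ProbabilityTheory Matrix

namespace RidgePLS

noncomputable section

/-- The `ℓ²` norm of a vector of `ℝᵐ`. -/
def l2 {m : ℕ} (v : Fin m → ℝ) : ℝ := ‖WithLp.toLp 2 v‖

/-- The highest eigenvalue `ρ(A)` of a (symmetric) real matrix. -/
def rho {m : ℕ} (A : Matrix (Fin m) (Fin m) ℝ) : ℝ := sSup (spectrum ℝ A)

/-- The lowest eigenvalue `ρ_min(A)` of a (symmetric) real matrix. -/
def rhoMin {m : ℕ} (A : Matrix (Fin m) (Fin m) ℝ) : ℝ := sInf (spectrum ℝ A)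

section Krylov

variable {p : ℕ}

/-- The Krylov matrix `(s, S s, …, S^{K-1} s)` of a `p × p` matrix `S` and a vector `s`. -/
def krylov (K : ℕ) (S : Matrix (Fin p) (Fin p) ℝ) (s : Fin p → ℝ) : Matrix (Fin p) (Fin K) ℝ :=
  Matrix.of fun a j => ((S ^ (j : ℕ)) *ᵥ s) a

/-- `Θ = Gᵀ S G`, where `G` is the Krylov matrix. -/
def krylovGram (K : ℕ) (S : Matrix (Fin p) (Fin p) ℝ) (s : Fin p → ℝ) :
    Matrix (Fin K) (Fin K) ℝ :=
  (krylov K S s)ᵀ * S * krylov K S s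

end Krylov

section Model

variable {n p : ℕ}

/-- The Gram matrix `Σ = (1/n) Xᵀ X`. -/
def designGram (X : Matrix (Fin n) (Fin p) ℝ) : Matrix (Fin p) (Fin p) ℝ := (1 / (n : ℝ)) • (Xᵀ * X)

/-- The empirical covariance `(1/n) Xᵀ y` between the design `X` and a response vector `y`. -/
def crossCov (X : Matrix (Fin n) (Fin p) ℝ) (y : Fin n → ℝ) : Fin p → ℝ :=
  (1 / (n : ℝ)) • (Xᵀ *ᵥ y)

/-- The response `Y = X β + ε`. -/
def response (X : Matrix (Fin n) (Fin p) ℝ) (β : Fin p → ℝ) (e : EuclideanSpace ℝ (Fin n)) :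
    Fin n → ℝ :=
  X *ᵥ β + e.ofLp

/-- The population covariance `σ = 𝔼[(1/n) Xᵀ Y] = (1/n) Xᵀ X β`
(see `integral_crossCov_response` for the first equality). -/
def popCov (X : Matrix (Fin n) (Fin p) ℝ) (β : Fin p → ℝ) : Fin p → ℝ := crossCov X (X *ᵥ β)

/-- The population Krylov matrix `G`. -/
def popG (K : ℕ) (X : Matrix (Fin n) (Fin p) ℝ) (β : Fin p → ℝ) : Matrix (Fin p) (Fin K) ℝ :=
  krylov K (designGram X) (popCov X β)

/-- The population matrix `Θ = Gᵀ Σ G`. -/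
def popTheta (K : ℕ) (X : Matrix (Fin n) (Fin p) ℝ) (β : Fin p → ℝ) : Matrix (Fin K) (Fin K) ℝ :=
  krylovGram K (designGram X) (popCov X β)

/-- The correlation matrix `R = D^{-1/2} Θ D^{-1/2}`, where `D = diag(Θ)`. -/
def corr (K : ℕ) (X : Matrix (Fin n) (Fin p) ℝ) (β : Fin p → ℝ) : Matrix (Fin K) (Fin K) ℝ :=
  diagonal (fun i => (√(popTheta K X β i i))⁻¹) * popTheta K X β *
    diagonal (fun i => (√(popTheta K X β i i))⁻¹)

/-- `Λ = Θ⁻¹ Gᵀ σ`. -/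
def lam (K : ℕ) (X : Matrix (Fin n) (Fin p) ℝ) (β : Fin p → ℝ) : Fin K → ℝ :=
  (popTheta K X β)⁻¹ *ᵥ ((popG K X β)ᵀ *ᵥ popCov X β)

/-- `Λ̃ = D^{1/2} Λ`. -/
def lamTilde (K : ℕ) (X : Matrix (Fin n) (Fin p) ℝ) (β : Fin p → ℝ) : Fin K → ℝ :=
  fun i => √(popTheta K X β i i) * lam K X β i

/-- `Λ̄ = D⁻¹ Gᵀ σ`. -/
def lamBar (K : ℕ) (X : Matrix (Fin n) (Fin p) ℝ) (β : Fin p → ℝ) : Fin K → ℝ :=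
  fun i => (popTheta K X β i i)⁻¹ * ((popG K X β)ᵀ *ᵥ popCov X β) i

/-- `inf_{v ∈ [G]} ‖X (β - v)‖²`, where `[G]` is the span of the columns of `G`. -/
def krylovBias (K : ℕ) (X : Matrix (Fin n) (Fin p) ℝ) (β : Fin p → ℝ) : ℝ :=
  ⨅ v : Submodule.span ℝ (Set.range (popG K X β).col), l2 (X *ᵥ (β - (v : Fin p → ℝ))) ^ 2

/-- The ridge PLS estimator `Ĝ (Θ̂ + Δ_α)⁻¹ Ĝᵀ σ̂` computed from the design `X`, the response `y`
and the ridge parameters `α₁, …, α_K`. -/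
def ridgePLS (K : ℕ) (X : Matrix (Fin n) (Fin p) ℝ) (α : Fin K → ℝ) (y : Fin n → ℝ) :
    Fin p → ℝ :=
  krylov K (designGram X) (crossCov X y) *ᵥ
    ((krylovGram K (designGram X) (crossCov X y) + diagonal α)⁻¹ *ᵥ
      ((krylov K (designGram X) (crossCov X y))ᵀ *ᵥ crossCov X y))

end Model

/-- `x_δ = ln(6K/δ)`. -/
def xDelta (K : ℕ) (δ : ℝ) : ℝ := Real.log (6 * K / δ)

/-- `C_δ = max(g(x_δ), 2√(2 x_δ))`, where `g(x) = 1 + 2x + 2√x`. -/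
def CDelta (K : ℕ) (δ : ℝ) : ℝ :=
  max (1 + 2 * xDelta K δ + 2 * √(xDelta K δ)) (2 * √(2 * xDelta K δ))

/-- `c_δ = 16 C_δ`. -/
def cDelta (K : ℕ) (δ : ℝ) : ℝ := 16 * CDelta K δ

/-- The ridge parameters `α_i = c_δ K (τ²/n) ρ(Σ)^i Tr(Σ^i)`, `1 ≤ i ≤ K`
(the entry `i : Fin K` is the parameter of index `i + 1`). -/
def ridgeParam {n p : ℕ} (K : ℕ) (X : Matrix (Fin n) (Fin p) ℝ) (τ δ : ℝ) : Fin K → ℝ :=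
  fun i => cDelta K δ * K * (τ ^ 2 / n) * rho (designGram X) ^ ((i : ℕ) + 1) *
    (designGram X ^ ((i : ℕ) + 1)).trace

/-- `σ` is the expectation of the empirical covariance `σ̂ = (1/n) Xᵀ Y`. -/
theorem integral_crossCov_response {Ω : Type*} [MeasurableSpace Ω] {μ : Measure Ω}
    {n p : ℕ} (X : Matrix (Fin n) (Fin p) ℝ) (β : Fin p → ℝ) (τ : ℝ)
    {ε : Ω → EuclideanSpace ℝ (Fin n)}
    (hε : HasLaw ε (multivariateGaussian 0 (τ ^ 2 • (1 : Matrix (Fin n) (Fin n) ℝ))) μ) :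
    ∫ ω, crossCov X (response X β (ε ω)) ∂μ = popCov X β := by
  have hprob : IsProbabilityMeasure μ := hε.isProbabilityMeasure_iff.2 inferInstance
  have hint : Integrable ε μ := by
    have h : Integrable id (μ.map ε) := by
      rw [hε.map_eq]
      exact IsGaussian.integrable_id
    exact h.comp_aemeasurable hε.aemeasurable
  have hmean : ∫ ω, ε ω ∂μ = 0 := by
    rw [hε.integral_eq, integral_id_multivariateGaussian]
  let L : EuclideanSpace ℝ (Fin n) →L[ℝ] (Fin p → ℝ) :=
    LinearMap.toContinuousLinearMap
      ((1 / (n : ℝ)) • (Xᵀ.mulVecLin ∘ₗ (WithLp.linearEquiv 2 ℝ (Fin n → ℝ)).toLinearMap))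
  have hL : ∀ ω, crossCov X (response X β (ε ω)) = popCov X β + L (ε ω) := by
    intro ω
    simp [L, crossCov, response, popCov, mulVec_add, mulVec_transpose]
  simp_rw [hL]
  rw [integral_add (integrable_const _) (L.integrable_comp hint), L.integral_comp_comm hint, hmean]
  simp

end

end RidgePLS

open RidgePLS

namespace RidgePLS

/-! The estimator is a ridge regression of `Y` on the random design `XĜ`. As `Ĝ` is linear in `Y`,
this design is `W + E` with `W = XG`, the columns of `E` being smoothed noise. `ridge_oracle` is the
deterministic core. Suppose `‖E h‖²/n` is at most an eighth of the penalty of `h`, and the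
correlations of the noise with `E h` and `W h` are at most half the penalty and half of `‖W h‖²/n`,
up to remainders. Then the risk is at most twice the bias, plus the remainders, plus 5/4 of the
penalty at `Λ`.

These conditions follow from `3K` noise inequalities (`NoiseControl`), which hold jointly with
probability at least `1 - δ` by a Gaussian tail bound and a union bound. The ridge parameters are
sized for the condition on `E`. Young's inequality leaves remainders of order `(τ²/n)
Tr(Σ^i)/ρ(Σ)^i` and `τ²/n` per coordinate, and `1 ≤ Λ̄_i ρ(Σ)^i` (`one_le_lamBar_mul`) turns both
into the third variance term. The first two variance terms are then slack. -/

/-! ### Gaussian tail bounds -/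

theorem dotProduct_self_nonneg {m : ℕ} (v : Fin m → ℝ) : 0 ≤ v ⬝ᵥ v :=
  Finset.sum_nonneg fun i _ => mul_self_nonneg (v i)

/-- A linear form of a centred isotropic Gaussian vector is a centred Gaussian variable. -/
theorem hasLaw_dotProduct {Ω : Type*} [MeasurableSpace Ω] {μ : Measure Ω} {n : ℕ} {τ : ℝ}
    {ε : Ω → EuclideanSpace ℝ (Fin n)}
    (hε : HasLaw ε (multivariateGaussian 0 (τ ^ 2 • (1 : Matrix (Fin n) (Fin n) ℝ))) μ)
    (a : Fin n → ℝ) :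
    HasLaw (fun ω => a ⬝ᵥ (ε ω).ofLp) (gaussianReal 0 (τ ^ 2 * (a ⬝ᵥ a)).toNNReal) μ := by
  have hS : (τ ^ 2 • (1 : Matrix (Fin n) (Fin n) ℝ)).PosSemidef :=
    PosSemidef.one.smul (sq_nonneg τ)
  let L : StrongDual ℝ (EuclideanSpace ℝ (Fin n)) := innerSL ℝ (WithLp.toLp 2 a)
  have hL : ∀ x, L x = a ⬝ᵥ x.ofLp := by
    intro x
    simp [L, PiLp.inner_apply, dotProduct, mul_comm]
  have hmap : (multivariateGaussian 0 (τ ^ 2 • (1 : Matrix (Fin n) (Fin n) ℝ))).map L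
      = gaussianReal 0 (τ ^ 2 * (a ⬝ᵥ a)).toNNReal := by
    rw [IsGaussian.map_eq_gaussianReal, L.integral_comp_id_comm IsGaussian.integrable_id,
      integral_id_multivariateGaussian, map_zero]
    congr 2
    have h := covarianceBilin_self (IsGaussian.memLp_two_id
      (μ := multivariateGaussian 0 (τ ^ 2 • (1 : Matrix (Fin n) (Fin n) ℝ))))
      (WithLp.toLp 2 a)
    rw [covarianceBilin_multivariateGaussian hS] at h
    simp only [smul_mulVec, one_mulVec, dotProduct_smul, smul_eq_mul] at h
    rw [h]
    rfl
  have h2 : HasLaw L (gaussianReal 0 (τ ^ 2 * (a ⬝ᵥ a)).toNNReal)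
      (multivariateGaussian 0 (τ ^ 2 • (1 : Matrix (Fin n) (Fin n) ℝ))) :=
    ⟨L.continuous.aemeasurable, hmap⟩
  have h3 := h2.fun_comp hε
  simpa only [hL] using h3

/-- `𝔼 exp (Z² / (4 v)) = √2` for `Z ∼ 𝒩(0, v)`. -/
theorem integral_exp_sq_gaussianReal {v : NNReal} (hv : v ≠ 0) :
    Integrable (fun x : ℝ => Real.exp (x ^ 2 / (4 * v))) (gaussianReal 0 v) ∧
      ∫ x, Real.exp (x ^ 2 / (4 * v)) ∂(gaussianReal 0 v) = √2 := by
  have hv' : (0 : ℝ) < v := by positivity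
  -- The tilt halves the Gaussian exponent, leaving the unnormalised density of variance `2v`; the
  -- ratio of normalisations is `√2`.
  have key : ∀ x : ℝ, gaussianPDFReal 0 v x * Real.exp (x ^ 2 / (4 * v))
      = (√(2 * Real.pi * v))⁻¹ * Real.exp (-(1 / (4 * v)) * x ^ 2) := by
    intro x
    rw [gaussianPDFReal, mul_assoc, ← Real.exp_add]
    congr 2
    field_simp
    ring
  have hb : (0 : ℝ) < 1 / (4 * v) := by positivity
  constructor
  · rw [gaussianReal_of_var_ne_zero 0 hv, gaussianPDF_def,
      integrable_withDensity_iff_integrable_smul' (by fun_prop) (by simp)]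
    simp only [ENNReal.toReal_ofReal (gaussianPDFReal_nonneg 0 v _), smul_eq_mul, key]
    exact (integrable_exp_neg_mul_sq hb).const_mul _
  · rw [integral_gaussianReal_eq_integral_smul hv]
    simp only [smul_eq_mul, key]
    rw [integral_const_mul, integral_gaussian, ← Real.sqrt_inv, ← Real.sqrt_mul (by positivity)]
    congr 1
    field_simp
    norm_num

theorem integral_exp_sq_dotProduct {Ω : Type*} [MeasurableSpace Ω] {μ : Measure Ω} {n : ℕ} {τ : ℝ}
    (hτ : 0 < τ) {ε : Ω → EuclideanSpace ℝ (Fin n)}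
    (hε : HasLaw ε (multivariateGaussian 0 (τ ^ 2 • (1 : Matrix (Fin n) (Fin n) ℝ))) μ)
    (a : Fin n → ℝ) (ha : 0 < a ⬝ᵥ a) :
    Integrable (fun ω => Real.exp ((a ⬝ᵥ (ε ω).ofLp) ^ 2 / (4 * (τ ^ 2 * (a ⬝ᵥ a))))) μ ∧
      ∫ ω, Real.exp ((a ⬝ᵥ (ε ω).ofLp) ^ 2 / (4 * (τ ^ 2 * (a ⬝ᵥ a)))) ∂μ = √2 := by
  have hpos : 0 < τ ^ 2 * (a ⬝ᵥ a) := by positivity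
  have hlaw := hasLaw_dotProduct hε a
  have hv : (τ ^ 2 * (a ⬝ᵥ a)).toNNReal ≠ 0 := by simpa using hpos
  obtain ⟨h1, h2⟩ := integral_exp_sq_gaussianReal hv
  rw [Real.coe_toNNReal _ hpos.le] at h1 h2
  constructor
  · rw [← hlaw.map_eq] at h1
    exact h1.comp_aemeasurable hlaw.aemeasurable
  · rw [← h2, ← hlaw.integral_comp h1.aestronglyMeasurable]
    rfl

/-- Tail bound for `‖B ε‖²`, where `ε` is a centred isotropic Gaussian vector. -/
theorem measureReal_mulVec_sq_gt_le {Ω : Type*} [MeasurableSpace Ω] {μ : Measure Ω} {m n : ℕ}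
    {τ : ℝ} (hτ : 0 < τ) {ε : Ω → EuclideanSpace ℝ (Fin n)}
    (hε : HasLaw ε (multivariateGaussian 0 (τ ^ 2 • (1 : Matrix (Fin n) (Fin n) ℝ))) μ)
    (B : Matrix (Fin m) (Fin n) ℝ) (u : ℝ) :
    μ.real {ω | u * τ ^ 2 * (Bᵀ * B).trace < (B *ᵥ (ε ω).ofLp) ⬝ᵥ (B *ᵥ (ε ω).ofLp)} ≤
      √2 * Real.exp (-u / 4) := by
  have hprob : IsProbabilityMeasure μ := hε.isProbabilityMeasure_iff.2 inferInstance
  set T := (Bᵀ * B).trace with hT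
  have hTsum : T = ∑ k, B k ⬝ᵥ B k := by
    rw [hT, trace_mul_comm]
    simp [trace, mul_apply, dotProduct]
  have hnn : ∀ k, 0 ≤ B k ⬝ᵥ B k := fun k => dotProduct_self_nonneg _
  have hT0 : 0 ≤ T := by rw [hTsum]; exact Finset.sum_nonneg fun k _ => hnn k
  -- If the trace vanishes then `B = 0`, and the strict inequality defines the empty event.
  rcases hT0.eq_or_lt with h0 | hTpos
  · have hB : ∀ k, B k = 0 := by
      intro k
      have := (Finset.sum_eq_zero_iff_of_nonneg (fun k _ => hnn k)).1 (hTsum.symm.trans h0.symm) k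
        (Finset.mem_univ k)
      exact dotProduct_self_eq_zero.1 this
    have hz : ∀ w : Fin n → ℝ, B *ᵥ w = 0 := by
      intro w
      ext k
      simp [mulVec, hB k]
    have : {ω | u * τ ^ 2 * T < (B *ᵥ (ε ω).ofLp) ⬝ᵥ (B *ᵥ (ε ω).ofLp)} = ∅ := by
      ext ω
      simp [hz, ← h0]
    rw [this]
    simp only [measureReal_empty]
    positivity
  · set Z : Fin m → Ω → ℝ := fun k ω =>
      Real.exp ((B k ⬝ᵥ (ε ω).ofLp) ^ 2 / (4 * (τ ^ 2 * (B k ⬝ᵥ B k)))) with hZ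
    set F : Ω → ℝ := fun ω => ∑ k, (B k ⬝ᵥ B k / T) * Z k ω with hF
    have hint : ∀ k, Integrable (fun ω => (B k ⬝ᵥ B k / T) * Z k ω) μ ∧
        ∫ ω, (B k ⬝ᵥ B k / T) * Z k ω ∂μ = (B k ⬝ᵥ B k / T) * √2 := by
      intro k
      rcases (hnn k).eq_or_lt with hk | hk
      · simp [← hk]
      · obtain ⟨h1, h2⟩ := integral_exp_sq_dotProduct hτ hε (B k) hk
        exact ⟨h1.const_mul _, by rw [integral_const_mul, h2]⟩
    have hFint : Integrable F μ := integrable_finsetSum _ fun k _ => (hint k).1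
    have hFval : ∫ ω, F ω ∂μ = √2 := by
      rw [hF, integral_finsetSum _ fun k _ => (hint k).1]
      simp only [(hint _).2]
      rw [← Finset.sum_mul, ← Finset.sum_div, ← hTsum, div_self hTpos.ne', one_mul]
    have hFnn : ∀ ω, 0 ≤ F ω := fun ω => Finset.sum_nonneg fun k _ =>
      mul_nonneg (div_nonneg (hnn k) hT0) (Real.exp_pos _).le
    have hsub : {ω | u * τ ^ 2 * T < (B *ᵥ (ε ω).ofLp) ⬝ᵥ (B *ᵥ (ε ω).ofLp)} ⊆
        {ω | Real.exp (u / 4) ≤ F ω} := by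
      intro ω hω
      simp only [Set.mem_ofPred_eq] at hω ⊢
      -- Jensen with weights `‖B_k‖²/T` bounds the exponential of `‖Bε‖²/(4τ²T)` by an average of
      -- variables of mean `√2`, so no independence of the coordinates of `Bε` is needed.
      have hjen := convexOn_exp.map_sum_le (t := Finset.univ)
        (w := fun k => B k ⬝ᵥ B k / T)
        (p := fun k => (B k ⬝ᵥ (ε ω).ofLp) ^ 2 / (4 * (τ ^ 2 * (B k ⬝ᵥ B k))))
        (fun k _ => div_nonneg (hnn k) hT0)
        (by rw [← Finset.sum_div, ← hTsum, div_self hTpos.ne']) (fun _ _ => Set.mem_univ _)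
      simp only [smul_eq_mul] at hjen
      refine le_trans (Real.exp_le_exp.2 ?_) hjen
      have hterm : ∀ k, (B k ⬝ᵥ B k / T) *
          ((B k ⬝ᵥ (ε ω).ofLp) ^ 2 / (4 * (τ ^ 2 * (B k ⬝ᵥ B k)))) =
          (B k ⬝ᵥ (ε ω).ofLp) ^ 2 / (4 * τ ^ 2 * T) := by
        intro k
        rcases (hnn k).eq_or_lt with hk | hk
        · rw [dotProduct_self_eq_zero.1 hk.symm]
          simp
        · field_simp
      simp only [hterm]
      rw [← Finset.sum_div, le_div_iff₀ (by positivity)]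
      have : (B *ᵥ (ε ω).ofLp) ⬝ᵥ (B *ᵥ (ε ω).ofLp) = ∑ k, (B k ⬝ᵥ (ε ω).ofLp) ^ 2 := by
        simp [dotProduct, mulVec, sq]
      rw [← this]
      linarith
    have hmarkov := mul_meas_ge_le_integral_of_nonneg (Filter.Eventually.of_forall hFnn) hFint
      (Real.exp (u / 4))
    rw [hFval] at hmarkov
    calc _ ≤ μ.real {ω | Real.exp (u / 4) ≤ F ω} := measureReal_mono hsub
      _ ≤ √2 * Real.exp (-u / 4) := by
        rw [neg_div, Real.exp_neg, ← div_eq_mul_inv, le_div_iff₀ (Real.exp_pos _), mul_comm]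
        exact hmarkov

/-! ### Spectral inequalities -/

theorem exists_diagonalization {m : ℕ} {A : Matrix (Fin m) (Fin m) ℝ} (hA : A.IsHermitian) :
    ∃ (U : Matrix (Fin m) (Fin m) ℝ) (d : Fin m → ℝ), Uᵀ * U = 1 ∧ U * Uᵀ = 1 ∧
      (∀ i, d i ∈ spectrum ℝ A) ∧ ∀ k : ℕ, A ^ k = U * diagonal (fun i => d i ^ k) * Uᵀ := by
  have hU := hA.eigenvectorUnitary.2
  refine ⟨hA.eigenvectorUnitary, hA.eigenvalues, ?_, ?_, hA.eigenvalues_mem_spectrum_real, ?_⟩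
  · simpa [star_eq_conjTranspose] using Unitary.star_mul_self_of_mem hU
  · simpa [star_eq_conjTranspose] using Unitary.mul_star_self_of_mem hU
  · intro k
    conv_lhs => rw [hA.spectral_theorem, ← map_pow, diagonal_pow, Unitary.conjStarAlgAut_apply]
    simp [star_eq_conjTranspose]
    rfl

theorem le_rho {m : ℕ} {A : Matrix (Fin m) (Fin m) ℝ} {x : ℝ} (hx : x ∈ spectrum ℝ A) :
    x ≤ rho A :=
  le_csSup (finite_real_spectrum).bddAbove hx

theorem rhoMin_le {m : ℕ} {A : Matrix (Fin m) (Fin m) ℝ} {x : ℝ} (hx : x ∈ spectrum ℝ A) :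
    rhoMin A ≤ x :=
  csInf_le (finite_real_spectrum).bddBelow hx

theorem dotProduct_conj_diagonal_mulVec {m : ℕ} (U : Matrix (Fin m) (Fin m) ℝ) (d v : Fin m → ℝ) :
    v ⬝ᵥ (U * diagonal d * Uᵀ) *ᵥ v = ∑ i, d i * (Uᵀ *ᵥ v) i ^ 2 := by
  rw [← mulVec_mulVec, ← mulVec_mulVec, dotProduct_mulVec, ← mulVec_transpose]
  simp only [dotProduct, mulVec_diagonal]
  exact Finset.sum_congr rfl fun i _ => by ring

theorem trace_conj_diagonal {m : ℕ} {U : Matrix (Fin m) (Fin m) ℝ} (hU : Uᵀ * U = 1)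
    (d : Fin m → ℝ) : (U * diagonal d * Uᵀ).trace = ∑ i, d i := by
  rw [trace_mul_comm, ← Matrix.mul_assoc, hU, Matrix.one_mul, trace_diagonal]

theorem rhoMin_mul_dotProduct_le {m : ℕ} {A : Matrix (Fin m) (Fin m) ℝ} (hA : A.IsHermitian)
    (v : Fin m → ℝ) : rhoMin A * (v ⬝ᵥ v) ≤ v ⬝ᵥ A *ᵥ v := by
  obtain ⟨U, d, -, hU, hd, hpow⟩ := exists_diagonalization hA
  have h1 := dotProduct_conj_diagonal_mulVec U d v
  have h0 := dotProduct_conj_diagonal_mulVec U (fun _ => 1) v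
  have hA1 := hpow 1
  simp only [pow_one] at hA1
  rw [← hA1] at h1
  rw [diagonal_one, Matrix.mul_one, hU, one_mulVec] at h0
  rw [h0, h1, Finset.mul_sum]
  refine Finset.sum_le_sum fun i _ => ?_
  rw [one_mul]
  exact mul_le_mul_of_nonneg_right (rhoMin_le (hd i)) (sq_nonneg _)

theorem rho_nonneg {m : ℕ} {A : Matrix (Fin m) (Fin m) ℝ} (hA : A.PosSemidef) : 0 ≤ rho A :=
  Real.sSup_nonneg fun _ hx => (posSemidef_iff_isHermitian_and_spectrum_nonneg.1 hA).2 hx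

/-- All eigenvalues lie in `[0, ρ(A)]`. With `j = k` this compares the size of the smoothed noise,
`Tr(Σ^{2j})`, with the ridge parameters. -/
theorem trace_pow_add_le {m : ℕ} {A : Matrix (Fin m) (Fin m) ℝ} (hA : A.PosSemidef) (j k : ℕ) :
    (A ^ (j + k)).trace ≤ rho A ^ j * (A ^ k).trace := by
  obtain ⟨U, d, hU, -, hd, hpow⟩ := exists_diagonalization hA.1
  have hd0 : ∀ i, 0 ≤ d i := fun i => (posSemidef_iff_isHermitian_and_spectrum_nonneg.1 hA).2 (hd i)
  rw [hpow, hpow, trace_conj_diagonal hU, trace_conj_diagonal hU, Finset.mul_sum]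
  refine Finset.sum_le_sum fun i _ => ?_
  rw [pow_add]
  exact mul_le_mul_of_nonneg_right (pow_le_pow_left₀ (hd0 i) (le_rho (hd i)) j)
    (pow_nonneg (hd0 i) k)

theorem dotProduct_pow_add_mulVec_le {m : ℕ} {A : Matrix (Fin m) (Fin m) ℝ} (hA : A.PosSemidef)
    (j k : ℕ) (v : Fin m → ℝ) :
    v ⬝ᵥ (A ^ (j + k)) *ᵥ v ≤ rho A ^ j * (v ⬝ᵥ (A ^ k) *ᵥ v) := by
  obtain ⟨U, d, hU, -, hd, hpow⟩ := exists_diagonalization hA.1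
  have hd0 : ∀ i, 0 ≤ d i := fun i => (posSemidef_iff_isHermitian_and_spectrum_nonneg.1 hA).2 (hd i)
  rw [hpow, hpow, dotProduct_conj_diagonal_mulVec, dotProduct_conj_diagonal_mulVec, Finset.mul_sum]
  refine Finset.sum_le_sum fun i _ => ?_
  rw [pow_add, ← mul_assoc]
  exact mul_le_mul_of_nonneg_right (mul_le_mul_of_nonneg_right
    (pow_le_pow_left₀ (hd0 i) (le_rho (hd i)) j) (pow_nonneg (hd0 i) k)) (sq_nonneg _)

/-! ### Deterministic oracle inequality -/

theorem dotProduct_sub_self_le {m : ℕ} (v w : Fin m → ℝ) :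
    (v - w) ⬝ᵥ (v - w) ≤ 2 * (v ⬝ᵥ v) + 2 * (w ⬝ᵥ w) := by
  have h := dotProduct_self_nonneg (v + w)
  simp only [dotProduct_add, add_dotProduct, dotProduct_sub, sub_dotProduct] at h ⊢
  linarith

/-- Cauchy–Schwarz in each row; this is the source of the factor `K` in the ridge parameters. -/
theorem mulVec_dotProduct_self_le {m K : ℕ} (A : Matrix (Fin m) (Fin K) ℝ) (θ : Fin K → ℝ) :
    (A *ᵥ θ) ⬝ᵥ (A *ᵥ θ) ≤ K * ∑ j, θ j ^ 2 * (A.col j ⬝ᵥ A.col j) := by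
  have h : ∀ a, (A *ᵥ θ) a * (A *ᵥ θ) a ≤ K * ∑ j, (A a j * θ j) ^ 2 := by
    intro a
    have := sq_sum_le_card_mul_sum_sq (s := Finset.univ) (f := fun j => A a j * θ j)
    simpa [sq, mulVec, dotProduct] using this
  calc (A *ᵥ θ) ⬝ᵥ (A *ᵥ θ) ≤ ∑ a, K * ∑ j, (A a j * θ j) ^ 2 := Finset.sum_le_sum fun a _ => h a
    _ = K * ∑ j, θ j ^ 2 * (A.col j ⬝ᵥ A.col j) := by
      rw [← Finset.mul_sum, Finset.sum_comm]
      congr 1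
      refine Finset.sum_congr rfl fun j _ => ?_
      simp only [dotProduct, Finset.mul_sum, col_apply]
      exact Finset.sum_congr rfl fun a _ => by ring

theorem dotProduct_mulVec_eq_sum_col {m K : ℕ} (e : Fin m → ℝ) (A : Matrix (Fin m) (Fin K) ℝ)
    (θ : Fin K → ℝ) : e ⬝ᵥ A *ᵥ θ = ∑ j, θ j * (e ⬝ᵥ A.col j) := by
  rw [dotProduct_mulVec, dotProduct_comm]
  rfl

/-- Oracle inequality for ridge regression of `f + e` on a perturbed design `W + E`. -/
theorem ridge_oracle {m K : ℕ} {N : ℝ} (hN : 0 < N) (W E : Matrix (Fin m) (Fin K) ℝ)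
    (f e : Fin m → ℝ) (α θ ℓ : Fin K → ℝ) (s₁ s₂ : ℝ)
    (hnormal : ∀ h : Fin K → ℝ,
      1 / N * (((W + E) *ᵥ h) ⬝ᵥ (f + e - (W + E) *ᵥ θ)) = ∑ j, α j * θ j * h j)
    (hE : ∀ h : Fin K → ℝ, 1 / N * ((E *ᵥ h) ⬝ᵥ (E *ᵥ h)) ≤ 1 / 8 * ∑ j, α j * h j ^ 2)
    (hEe : ∀ h : Fin K → ℝ, 2 / N * (e ⬝ᵥ E *ᵥ h) ≤ 1 / 2 * ∑ j, α j * h j ^ 2 + s₁)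
    (hWe : ∀ h : Fin K → ℝ,
      2 / N * (e ⬝ᵥ W *ᵥ h) ≤ 1 / 2 * (1 / N * ((W *ᵥ h) ⬝ᵥ (W *ᵥ h))) + s₂)
    (hα : ∀ j, 0 ≤ α j) :
    1 / N * (((W + E) *ᵥ θ - f) ⬝ᵥ ((W + E) *ᵥ θ - f)) ≤
      2 / N * ((f - W *ᵥ ℓ) ⬝ᵥ (f - W *ᵥ ℓ)) + s₁ + s₂ + 5 / 4 * ∑ j, α j * ℓ j ^ 2 := by
  set h : Fin K → ℝ := θ - ℓ with hh
  set g : Fin m → ℝ := f - (W + E) *ᵥ θ with hg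
  set v : Fin m → ℝ := (W + E) *ᵥ h with hv
  have e1 : (W + E) *ᵥ θ - f = -g := by rw [hg]; abel
  have e2 : f - W *ᵥ ℓ - E *ᵥ ℓ = g + v := by
    rw [hg, hv, hh, mulVec_sub, add_mulVec W E ℓ]; abel
  have e3 : W *ᵥ h = v - E *ᵥ h := by rw [hv, add_mulVec]; abel
  have e4 : f + e - (W + E) *ᵥ θ = g + e := by rw [hg]; abel
  have n1 := hnormal h
  rw [e4, ← hv] at n1
  have n2 := dotProduct_sub_self_le (f - W *ᵥ ℓ) (E *ᵥ ℓ)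
  rw [e2] at n2
  have n3 := dotProduct_sub_self_le v (E *ᵥ h)
  rw [← e3] at n3
  have n4 := hE h
  have n5 := hE ℓ
  have n6 := hEe h
  have n7 := hWe h
  have n8 : e ⬝ᵥ v = e ⬝ᵥ W *ᵥ h + e ⬝ᵥ E *ᵥ h := by rw [← dotProduct_add, e3]; congr 1; abel
  -- Polarisation, using `ℓ = θ - h`. The term in `h` is what absorbs the noise.
  have n9 : 2 * ∑ j, α j * θ j * h j =
      ∑ j, α j * θ j ^ 2 + ∑ j, α j * h j ^ 2 - ∑ j, α j * ℓ j ^ 2 := by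
    rw [← Finset.sum_add_distrib, ← Finset.sum_sub_distrib, Finset.mul_sum]
    refine Finset.sum_congr rfl fun j _ => ?_
    simp only [hh, Pi.sub_apply]
    ring
  have n10 : 0 ≤ ∑ j, α j * θ j ^ 2 := Finset.sum_nonneg fun j _ => mul_nonneg (hα j) (sq_nonneg _)
  have n11 : 0 ≤ ∑ j, α j * h j ^ 2 := Finset.sum_nonneg fun j _ => mul_nonneg (hα j) (sq_nonneg _)
  rw [e1, neg_dotProduct_neg]
  simp only [dotProduct_add, add_dotProduct, dotProduct_comm v g, dotProduct_comm v e] at n1 n2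
  have hi : (0 : ℝ) < 1 / N := by positivity
  rw [show (2 : ℝ) / N = 2 * (1 / N) by ring] at n6 n7 ⊢
  generalize (1 : ℝ) / N = i at *
  have n2' := mul_le_mul_of_nonneg_left n2 hi.le
  have n3' := mul_le_mul_of_nonneg_left n3 hi.le
  rw [n8] at n1
  -- Expanding `‖g + v‖²` and eliminating `⟨g, v⟩` by `n1` leaves `-‖v‖²/N`, which cancels half of
  -- `‖W h‖²/N` up to `‖E h‖²/N`. The penalty of `h` then has coefficient `-1 + 1/2 + 1/8 < 0`, and
  -- that of `ℓ` is `1 + 2/8 = 5/4`.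
  linarith

/-! ### Krylov directions as smoothers, and the normal equations -/

/-- The smoothing matrix `(1/n) X Σʲ Xᵀ`, which maps `y` to `X Σʲ σ̂(y)`. -/
noncomputable def smoother {n p : ℕ} (X : Matrix (Fin n) (Fin p) ℝ) (j : ℕ) :
    Matrix (Fin n) (Fin n) ℝ :=
  (1 / (n : ℝ)) • (X * designGram X ^ j * Xᵀ)

/-- The matrix `X Ĝ` of fitted Krylov directions for the response `y`. -/
noncomputable def fitMatrix {n p : ℕ} (K : ℕ) (X : Matrix (Fin n) (Fin p) ℝ) (y : Fin n → ℝ) :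
    Matrix (Fin n) (Fin K) ℝ :=
  X * krylov K (designGram X) (crossCov X y)

section

variable {n p K : ℕ} (X : Matrix (Fin n) (Fin p) ℝ)

theorem designGram_posSemidef : (designGram X).PosSemidef := by
  have h := (posSemidef_conjTranspose_mul_self X).smul (a := 1 / (n : ℝ)) (by positivity)
  simpa [designGram] using h

theorem smoother_posSemidef (j : ℕ) : (smoother X j).PosSemidef := by
  have h := (((designGram_posSemidef X).pow j).mul_mul_conjTranspose_same X).smul
    (a := 1 / (n : ℝ)) (by positivity)
  simpa [smoother] using h

theorem trace_smoother (j : ℕ) : (smoother X j).trace = (designGram X ^ (j + 1)).trace := by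
  rw [smoother, ← Matrix.smul_mul, trace_mul_comm, Matrix.mul_smul, ← Matrix.mul_assoc,
    ← Matrix.smul_mul, pow_succ']
  rfl

theorem smoother_transpose (j : ℕ) : (smoother X j)ᵀ = smoother X j := by
  simpa using (smoother_posSemidef X j).1.eq

/-- The inner factor `(1/n) XᵀX` is one more power of `Σ`, hence the `+ 1`. -/
theorem smoother_mul_smoother (i j : ℕ) : smoother X i * smoother X j = smoother X (i + j + 1) := by
  have h : designGram X ^ i * ((1 / (n : ℝ)) • (Xᵀ * X)) * designGram X ^ j =
      designGram X ^ (i + j + 1) := by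
    change designGram X ^ i * designGram X * designGram X ^ j = _
    rw [← pow_succ, ← pow_add]
    congr 1
    ring
  simp only [smoother]
  rw [← h]
  simp only [Matrix.smul_mul, Matrix.mul_smul, Matrix.mul_assoc]

theorem fitMatrix_col (y : Fin n → ℝ) (j : Fin K) :
    (fitMatrix K X y).col j = smoother X j *ᵥ y := by
  have h : (krylov K (designGram X) (crossCov X y)).col j =
      (designGram X ^ (j : ℕ)) *ᵥ crossCov X y := by
    ext a; rfl
  have h2 : (fitMatrix K X y).col j = X *ᵥ (krylov K (designGram X) (crossCov X y)).col j := by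
    ext a; rfl
  rw [h2, h, crossCov, smoother]
  simp only [mulVec_smul, smul_mulVec, mulVec_mulVec, Matrix.mul_assoc]

theorem fitMatrix_add (y z : Fin n → ℝ) :
    fitMatrix K X (y + z) = fitMatrix K X y + fitMatrix K X z := by
  ext a j
  have h : ∀ w, fitMatrix K X w a j = (smoother X j *ᵥ w) a := fun w => by
    rw [← fitMatrix_col (K := K)]; rfl
  simp [h, mulVec_add]

theorem krylovGram_eq (y : Fin n → ℝ) :
    krylovGram K (designGram X) (crossCov X y) =
      (1 / (n : ℝ)) • ((fitMatrix K X y)ᵀ * fitMatrix K X y) := by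
  rw [krylovGram, fitMatrix, transpose_mul]
  conv_lhs => enter [1, 2]; rw [designGram]
  simp only [Matrix.smul_mul, Matrix.mul_smul, Matrix.mul_assoc]

theorem krylov_transpose_mulVec_crossCov (y : Fin n → ℝ) :
    (krylov K (designGram X) (crossCov X y))ᵀ *ᵥ crossCov X y =
      (1 / (n : ℝ)) • ((fitMatrix K X y)ᵀ *ᵥ y) := by
  rw [fitMatrix, transpose_mul]
  conv_lhs => enter [2]; rw [crossCov]
  rw [mulVec_smul, mulVec_mulVec]

theorem dotProduct_krylovGram_mulVec (y : Fin n → ℝ) (v : Fin K → ℝ) :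
    v ⬝ᵥ krylovGram K (designGram X) (crossCov X y) *ᵥ v =
      1 / (n : ℝ) * ((fitMatrix K X y *ᵥ v) ⬝ᵥ (fitMatrix K X y *ᵥ v)) := by
  rw [krylovGram_eq, smul_mulVec, dotProduct_smul, ← mulVec_mulVec, dotProduct_mulVec,
    vecMul_transpose, smul_eq_mul]

theorem krylovGram_posSemidef (y : Fin n → ℝ) :
    (krylovGram K (designGram X) (crossCov X y)).PosSemidef := by
  have h := (posSemidef_conjTranspose_mul_self (fitMatrix K X y)).smul (a := 1 / (n : ℝ))
    (by positivity)
  rw [krylovGram_eq]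
  simpa using h

theorem krylovGram_diag (y : Fin n → ℝ) (j : Fin K) :
    krylovGram K (designGram X) (crossCov X y) j j =
      1 / (n : ℝ) * ((smoother X j *ᵥ y) ⬝ᵥ (smoother X j *ᵥ y)) := by
  rw [krylovGram_eq, ← fitMatrix_col (K := K)]
  simp [mul_apply, dotProduct]

/-- The normal equations satisfied by the ridge coefficients. -/
theorem ridge_normal_equation {α : Fin K → ℝ} (hα : ∀ j, 0 < α j) (y : Fin n → ℝ) :
    ∃ θ : Fin K → ℝ, X *ᵥ ridgePLS K X α y = fitMatrix K X y *ᵥ θ ∧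
      ∀ h : Fin K → ℝ, 1 / (n : ℝ) * ((fitMatrix K X y *ᵥ h) ⬝ᵥ (y - fitMatrix K X y *ᵥ θ)) =
        ∑ j, α j * θ j * h j := by
  set A := krylovGram K (designGram X) (crossCov X y) + diagonal α with hA
  have hpd : A.PosDef := (PosDef.diagonal hα).posSemidef_add (krylovGram_posSemidef X y)
  have hunit : IsUnit A.det := (isUnit_iff_isUnit_det A).1 hpd.isUnit
  set b := (krylov K (designGram X) (crossCov X y))ᵀ *ᵥ crossCov X y with hb
  refine ⟨A⁻¹ *ᵥ b, by rw [ridgePLS, mulVec_mulVec]; rfl, fun h => ?_⟩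
  have hs : A *ᵥ (A⁻¹ *ᵥ b) = b := by rw [mulVec_mulVec, mul_nonsing_inv _ hunit, one_mulVec]
  generalize A⁻¹ *ᵥ b = θ at hs ⊢
  have h1 : h ⬝ᵥ (krylovGram K (designGram X) (crossCov X y) *ᵥ θ) + h ⬝ᵥ (diagonal α *ᵥ θ) =
      h ⬝ᵥ b := by
    rw [← hs, hA, add_mulVec, dotProduct_add]
  have h2 : h ⬝ᵥ (diagonal α *ᵥ θ) = ∑ j, α j * θ j * h j := by
    simp only [dotProduct, mulVec_diagonal]
    exact Finset.sum_congr rfl fun j _ => by ring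
  rw [← h2, eq_sub_of_add_eq' h1, hb, krylov_transpose_mulVec_crossCov, krylovGram_eq, smul_mulVec,
    dotProduct_smul, dotProduct_smul, ← mulVec_mulVec, dotProduct_mulVec, dotProduct_mulVec,
    vecMul_transpose, dotProduct_sub, smul_eq_mul, smul_eq_mul]
  ring

end

/-! ### Population quantities -/

section

variable {n p K : ℕ} (X : Matrix (Fin n) (Fin p) ℝ) (β : Fin p → ℝ)

theorem popTheta_posSemidef : (popTheta K X β).PosSemidef := krylovGram_posSemidef X _

theorem corr_isHermitian : (corr K X β).IsHermitian := by
  have h := (popTheta_posSemidef (K := K) X β).1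
  rw [IsHermitian, conjTranspose_eq_transpose_of_trivial] at h ⊢
  simp [corr, transpose_mul, h, Matrix.mul_assoc]

variable {X β}

/-- A zero diagonal entry of `Θ` would make that of `R` zero too, since `0⁻¹ = 0`, against `ρ_min(R)
> 0` tested on a basis vector. -/
theorem popTheta_diag_pos (hR : 0 < rhoMin (corr K X β)) (j : Fin K) : 0 < popTheta K X β j j := by
  have h0 : 0 ≤ popTheta K X β j j := (popTheta_posSemidef X β).diag_nonneg
  refine h0.lt_of_ne fun h => ?_
  have h1 := rhoMin_mul_dotProduct_le (corr_isHermitian (K := K) X β) (Pi.single j 1)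
  have h2 : corr K X β j j = 0 := by simp [corr, ← h]
  simp [h2] at h1
  linarith

/-- Rayleigh bound for `R` at `D^{1/2} v`. It decouples the coordinates, so that Young's inequality
can be applied to each separately. -/
theorem rhoMin_corr_mul_le (hR : 0 < rhoMin (corr K X β)) (v : Fin K → ℝ) :
    rhoMin (corr K X β) * ∑ j, popTheta K X β j j * v j ^ 2 ≤ v ⬝ᵥ popTheta K X β *ᵥ v := by
  set w : Fin K → ℝ := diagonal (fun i => √(popTheta K X β i i)) *ᵥ v with hw
  have hinv : diagonal (fun i => (√(popTheta K X β i i))⁻¹) *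
      diagonal (fun i => √(popTheta K X β i i)) = (1 : Matrix (Fin K) (Fin K) ℝ) := by
    rw [diagonal_mul_diagonal, ← diagonal_one]
    congr 1
    ext i
    exact inv_mul_cancel₀ (Real.sqrt_pos.2 (popTheta_diag_pos hR i)).ne'
  have hv : diagonal (fun i => (√(popTheta K X β i i))⁻¹) *ᵥ w = v := by
    rw [hw, mulVec_mulVec, hinv, one_mulVec]
  have h1 := rhoMin_mul_dotProduct_le (corr_isHermitian (K := K) X β) w
  have h2 : w ⬝ᵥ corr K X β *ᵥ w = v ⬝ᵥ popTheta K X β *ᵥ v := by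
    rw [corr, ← mulVec_mulVec, ← mulVec_mulVec, hv, dotProduct_mulVec, ← mulVec_transpose,
      diagonal_transpose, hv]
  have h3 : w ⬝ᵥ w = ∑ j, popTheta K X β j j * v j ^ 2 := by
    refine Finset.sum_congr rfl fun j _ => ?_
    rw [hw, mulVec_diagonal]
    have := Real.mul_self_sqrt (popTheta_diag_pos hR j).le
    linear_combination v j ^ 2 * this
  rwa [h2, h3] at h1

theorem popTheta_isUnit_det (hR : 0 < rhoMin (corr K X β)) : IsUnit (popTheta K X β).det := by
  rw [← isUnit_iff_isUnit_det]
  refine PosDef.isUnit (PosDef.of_dotProduct_mulVec_pos (popTheta_posSemidef X β).1 fun v hv => ?_)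
  obtain ⟨j, hj⟩ := Function.ne_iff.1 hv
  refine lt_of_lt_of_le (mul_pos hR ?_) (rhoMin_corr_mul_le hR v)
  refine Finset.sum_pos' (fun i _ => mul_nonneg (popTheta_diag_pos hR i).le (sq_nonneg _))
    ⟨j, Finset.mem_univ j, mul_pos (popTheta_diag_pos hR j) ?_⟩
  have hj' : v j ≠ 0 := hj
  positivity

/-- `Λ` are least squares coefficients: the residual is orthogonal to the columns of `X G`. -/
theorem fitMatrix_transpose_mulVec_residual (hn : 0 < n) (hR : 0 < rhoMin (corr K X β)) :
    (fitMatrix K X (X *ᵥ β))ᵀ *ᵥ (X *ᵥ β - fitMatrix K X (X *ᵥ β) *ᵥ lam K X β) = 0 := by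
  have hn' : (1 / (n : ℝ)) ≠ 0 := by positivity
  have h1 : popTheta K X β *ᵥ lam K X β = (popG K X β)ᵀ *ᵥ popCov X β := by
    rw [lam, mulVec_mulVec, mul_nonsing_inv _ (popTheta_isUnit_det hR), one_mulVec]
  have h2 : (popG K X β)ᵀ *ᵥ popCov X β =
      (1 / (n : ℝ)) • ((fitMatrix K X (X *ᵥ β))ᵀ *ᵥ (X *ᵥ β)) :=
    krylov_transpose_mulVec_crossCov X (X *ᵥ β)
  have h3 : popTheta K X β =
      (1 / (n : ℝ)) • ((fitMatrix K X (X *ᵥ β))ᵀ * fitMatrix K X (X *ᵥ β)) :=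
    krylovGram_eq X (X *ᵥ β)
  rw [h2, h3, smul_mulVec] at h1
  rw [mulVec_sub, sub_eq_zero, mulVec_mulVec (lam K X β)]
  exact (smul_right_injective _ hn' h1).symm

theorem l2_sq {m : ℕ} (v : Fin m → ℝ) : l2 v ^ 2 = v ⬝ᵥ v := by
  rw [l2, EuclideanSpace.real_norm_sq_eq]
  exact Finset.sum_congr rfl fun i _ => sq (v i)

theorem residual_le_krylovBias (hn : 0 < n) (hR : 0 < rhoMin (corr K X β)) :
    (X *ᵥ β - fitMatrix K X (X *ᵥ β) *ᵥ lam K X β) ⬝ᵥ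
      (X *ᵥ β - fitMatrix K X (X *ᵥ β) *ᵥ lam K X β) ≤ krylovBias K X β := by
  refine le_ciInf ?_
  rintro ⟨v, hv⟩
  change _ ≤ l2 (X *ᵥ (β - v)) ^ 2
  rw [← range_mulVecLin] at hv
  obtain ⟨c, hc⟩ := hv
  rw [mulVecLin_apply] at hc
  set W := fitMatrix K X (X *ᵥ β) with hW
  set r := X *ᵥ β - W *ᵥ lam K X β with hr
  have horth : Wᵀ *ᵥ r = 0 := fitMatrix_transpose_mulVec_residual hn hR
  -- Pythagoras: any competitor in the span differs from the least squares fit by a vector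
  -- orthogonal to `r`.
  have h1 : X *ᵥ (β - v) = r + W *ᵥ (lam K X β - c) := by
    rw [← hc, mulVec_sub, mulVec_mulVec, mulVec_sub, hr]
    change _ - W *ᵥ c = _
    abel
  have h2 : r ⬝ᵥ W *ᵥ (lam K X β - c) = 0 := by
    rw [dotProduct_mulVec, ← mulVec_transpose, horth, zero_dotProduct]
  have h3 := dotProduct_self_nonneg (W *ᵥ (lam K X β - c))
  rw [l2_sq, h1, dotProduct_add, add_dotProduct, add_dotProduct,
    dotProduct_comm (W *ᵥ (lam K X β - c)) r, h2]
  linarith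

theorem popTheta_diag_eq (j : Fin K) : popTheta K X β j j =
    popCov X β ⬝ᵥ (designGram X ^ ((j : ℕ) + 1 + j)) *ᵥ popCov X β := by
  have hs : (designGram X ^ (j : ℕ))ᵀ = designGram X ^ (j : ℕ) := by
    simpa using ((designGram_posSemidef X).pow (j : ℕ)).1.eq
  have h0 : (krylov K (designGram X) (popCov X β)).col j =
      (designGram X ^ (j : ℕ)) *ᵥ popCov X β := by
    ext a; rfl
  have h1 : popTheta K X β j j = (krylov K (designGram X) (popCov X β)).col j ⬝ᵥ
      designGram X *ᵥ (krylov K (designGram X) (popCov X β)).col j := by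
    rw [popTheta, krylovGram, dotProduct_mulVec, Matrix.mul_apply_eq_vecMul]
    rfl
  rw [h1, h0, mulVec_mulVec, ← pow_succ', dotProduct_comm, dotProduct_mulVec, ← mulVec_transpose,
    hs, mulVec_mulVec, ← pow_add, dotProduct_comm]
  congr 3
  ring

theorem popG_transpose_mulVec_apply (j : Fin K) : ((popG K X β)ᵀ *ᵥ popCov X β) j =
    popCov X β ⬝ᵥ (designGram X ^ (j : ℕ)) *ᵥ popCov X β := by
  rw [dotProduct_comm]
  rfl

/-- `Θ_jj` carries `j + 1` more powers of `Σ` than `(Gᵀσ)_j` (indices from 0), each costing at most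
`ρ(Σ)`. -/
theorem one_le_lamBar_mul (hR : 0 < rhoMin (corr K X β)) (j : Fin K) :
    1 ≤ lamBar K X β j * rho (designGram X) ^ ((j : ℕ) + 1) := by
  have hpos := popTheta_diag_pos hR j
  have h := dotProduct_pow_add_mulVec_le (designGram_posSemidef X) ((j : ℕ) + 1) j (popCov X β)
  rw [← popTheta_diag_eq (K := K), ← popG_transpose_mulVec_apply (K := K)] at h
  rw [lamBar, inv_mul_eq_div, div_mul_eq_mul_div, le_div_iff₀ hpos]
  linarith

theorem rho_designGram_pos (hR : 0 < rhoMin (corr K X β)) (j : Fin K) :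
    0 < rho (designGram X) := by
  refine (rho_nonneg (designGram_posSemidef X)).lt_of_ne fun h => ?_
  have := one_le_lamBar_mul hR j
  rw [← h, zero_pow (Nat.succ_ne_zero _)] at this
  linarith

theorem lamBar_nonneg (j : Fin K) : 0 ≤ lamBar K X β j := by
  refine mul_nonneg (inv_nonneg.2 (popTheta_posSemidef X β).diag_nonneg) ?_
  rw [popG_transpose_mulVec_apply]
  simpa using ((designGram_posSemidef X).pow (j : ℕ)).dotProduct_mulVec_nonneg (popCov X β)

/-- A zero trace would force `Σ^{j+1} = 0`, a factor of the power of `Σ` in `Θ_jj > 0`. -/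
theorem trace_designGram_pow_pos (hR : 0 < rhoMin (corr K X β)) (j : Fin K) :
    0 < (designGram X ^ ((j : ℕ) + 1)).trace := by
  have hps := (designGram_posSemidef X).pow ((j : ℕ) + 1)
  refine hps.trace_nonneg.lt_of_ne fun h => ?_
  have hz : designGram X ^ ((j : ℕ) + 1) = 0 := hps.trace_eq_zero_iff.1 h.symm
  have hpos := popTheta_diag_pos hR j
  rw [popTheta_diag_eq, pow_add, hz] at hpos
  simp at hpos

end

theorem two_mul_mul_le {a b x : ℝ} (ha : 0 < a) : 2 * (x * b) ≤ a * x ^ 2 + b ^ 2 / a := by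
  have h : a * x ^ 2 + b ^ 2 / a - 2 * (x * b) = (a * x - b) ^ 2 / a := by
    field_simp
    ring
  have := div_nonneg (sq_nonneg (a * x - b)) ha.le
  linarith

/-! ### The noise event and its probability -/

section Probability

variable {Ω : Type*} [MeasurableSpace Ω] {μ : Measure Ω} {n : ℕ} {τ : ℝ}
  {ε : Ω → EuclideanSpace ℝ (Fin n)}

open scoped MatrixOrder in
-- With `A = BᵀB`, `B` the positive square root, the quadratic form is `‖Bε‖²`.
theorem measureReal_dotProduct_mulVec_gt_le (hτ : 0 < τ)
    (hε : HasLaw ε (multivariateGaussian 0 (τ ^ 2 • (1 : Matrix (Fin n) (Fin n) ℝ))) μ)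
    {A : Matrix (Fin n) (Fin n) ℝ} (hA : A.PosSemidef) (u : ℝ) :
    μ.real {ω | u * τ ^ 2 * A.trace < (ε ω).ofLp ⬝ᵥ A *ᵥ (ε ω).ofLp} ≤
      √2 * Real.exp (-u / 4) := by
  obtain ⟨B, hB⟩ : ∃ B : Matrix (Fin n) (Fin n) ℝ, A = Bᵀ * B := by
    refine ⟨CFC.sqrt A, ?_⟩
    have hs : (CFC.sqrt A)ᵀ = CFC.sqrt A := by
      simpa [star_eq_conjTranspose] using (CFC.sqrt_nonneg A).isSelfAdjoint.star_eq
    rw [hs, CFC.sqrt_mul_sqrt_self A hA.nonneg]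
  have h := measureReal_mulVec_sq_gt_le hτ hε B u
  rw [← hB] at h
  convert h using 5 with ω
  rw [hB, ← mulVec_mulVec, dotProduct_mulVec, vecMul_transpose]

theorem measureReal_dotProduct_sq_gt_le (hτ : 0 < τ)
    (hε : HasLaw ε (multivariateGaussian 0 (τ ^ 2 • (1 : Matrix (Fin n) (Fin n) ℝ))) μ)
    (a : Fin n → ℝ) (u : ℝ) :
    μ.real {ω | u * τ ^ 2 * (a ⬝ᵥ a) < ((ε ω).ofLp ⬝ᵥ a) ^ 2} ≤ √2 * Real.exp (-u / 4) := by
  have h := measureReal_mulVec_sq_gt_le hτ hε (Matrix.of fun _ : Fin 1 => a) u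
  rw [trace_mul_comm] at h
  convert h using 6 with ω
  · simp [trace, mul_apply, dotProduct]
  · simp [dotProduct, mulVec, sq, mul_comm]

end Probability

theorem xDelta_pos {K : ℕ} (hK : 1 ≤ K) {δ : ℝ} (hδ : δ ∈ Set.Ioo (0 : ℝ) 1) : 0 < xDelta K δ := by
  refine Real.log_pos ?_
  have hK' : (1 : ℝ) ≤ K := by exact_mod_cast hK
  rw [lt_div_iff₀ hδ.1]
  linarith [hδ.2]

theorem CDelta_pos {K : ℕ} (hK : 1 ≤ K) {δ : ℝ} (hδ : δ ∈ Set.Ioo (0 : ℝ) 1) : 0 < CDelta K δ := by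
  refine lt_of_lt_of_le ?_ (le_max_left _ _)
  have := xDelta_pos hK hδ
  positivity

theorem sqrt_two_mul_exp_le {K : ℕ} (hK : 1 ≤ K) {δ : ℝ} (hδ : δ ∈ Set.Ioo (0 : ℝ) 1) :
    √2 * Real.exp (-(2 * CDelta K δ) / 4) ≤ δ / (6 * K) := by
  have hx := xDelta_pos hK hδ
  have hC : 1 + 2 * xDelta K δ ≤ CDelta K δ :=
    le_trans (by linarith [Real.sqrt_nonneg (xDelta K δ)]) (le_max_left _ _)
  have hK' : (0 : ℝ) < K := by exact_mod_cast hK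
  have h1 : Real.exp (-(2 * CDelta K δ) / 4) ≤ Real.exp (-(1 / 2)) * Real.exp (-xDelta K δ) := by
    rw [← Real.exp_add, Real.exp_le_exp]
    linarith
  have h2 : Real.exp (-xDelta K δ) = δ / (6 * K) := by
    rw [Real.exp_neg, xDelta, Real.exp_log (div_pos (by positivity) hδ.1), inv_div]
  -- The constant 1 in `C_δ` absorbs the prefactor `√2`, because `2 ≤ e`.
  have h3 : √2 * Real.exp (-(1 / 2)) ≤ 1 := by
    rw [Real.exp_neg, ← div_eq_mul_inv, div_le_one (Real.exp_pos _)]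
    refine Real.sqrt_le_iff.2 ⟨(Real.exp_pos _).le, ?_⟩
    rw [← Real.exp_nat_mul]
    have := Real.add_one_le_exp 1
    norm_num
    linarith
  rw [h2] at h1
  have h4 : 0 ≤ δ / (6 * K) := div_nonneg hδ.1.le (by positivity)
  calc √2 * Real.exp (-(2 * CDelta K δ) / 4)
      ≤ √2 * (Real.exp (-(1 / 2)) * (δ / (6 * K))) := by gcongr
    _ = (√2 * Real.exp (-(1 / 2))) * (δ / (6 * K)) := by ring
    _ ≤ δ / (6 * K) := mul_le_of_le_one_left h4 h3

section

variable {n p K : ℕ} {X : Matrix (Fin n) (Fin p) ℝ} {β : Fin p → ℝ} {τ δ : ℝ}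

/-- The event on which the noise `e` behaves as expected, at level `q`. -/
structure NoiseControl (K : ℕ) (X : Matrix (Fin n) (Fin p) ℝ) (β : Fin p → ℝ) (τ q : ℝ)
    (e : Fin n → ℝ) : Prop where
  smoothed : ∀ j : Fin K, (smoother X j *ᵥ e) ⬝ᵥ (smoother X j *ᵥ e) ≤
    q * τ ^ 2 * (designGram X ^ ((j : ℕ) + 1 + ((j : ℕ) + 1))).trace
  quadratic : ∀ j : Fin K, e ⬝ᵥ smoother X j *ᵥ e ≤
    q * τ ^ 2 * (designGram X ^ ((j : ℕ) + 1)).trace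
  linear : ∀ j : Fin K, (e ⬝ᵥ smoother X j *ᵥ (X *ᵥ β)) ^ 2 ≤
    q * τ ^ 2 * ((smoother X j *ᵥ (X *ᵥ β)) ⬝ᵥ (smoother X j *ᵥ (X *ᵥ β)))

theorem one_sub_le_measureReal_noiseControl {Ω : Type*} [MeasurableSpace Ω] {μ : Measure Ω}
    {ε : Ω → EuclideanSpace ℝ (Fin n)} (hK : 1 ≤ K) (hδ : δ ∈ Set.Ioo (0 : ℝ) 1) (hτ : 0 < τ)
    (hε : HasLaw ε (multivariateGaussian 0 (τ ^ 2 • (1 : Matrix (Fin n) (Fin n) ℝ))) μ) :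
    1 - δ ≤ μ.real {ω | NoiseControl K X β τ (2 * CDelta K δ) (ε ω).ofLp} := by
  have hprob : IsProbabilityMeasure μ := hε.isProbabilityMeasure_iff.2 inferInstance
  set q := 2 * CDelta K δ with hq
  have hb := sqrt_two_mul_exp_le hK hδ
  rw [← hq] at hb
  set E₁ : Fin K → Set Ω := fun j => {ω | q * τ ^ 2 * ((smoother X j)ᵀ * smoother X j).trace <
    (smoother X j *ᵥ (ε ω).ofLp) ⬝ᵥ (smoother X j *ᵥ (ε ω).ofLp)}
  set E₂ : Fin K → Set Ω := fun j => {ω | q * τ ^ 2 * (smoother X j).trace <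
    (ε ω).ofLp ⬝ᵥ smoother X j *ᵥ (ε ω).ofLp}
  set E₃ : Fin K → Set Ω := fun j => {ω | q * τ ^ 2 *
    ((smoother X j *ᵥ (X *ᵥ β)) ⬝ᵥ (smoother X j *ᵥ (X *ᵥ β))) <
      ((ε ω).ofLp ⬝ᵥ smoother X j *ᵥ (X *ᵥ β)) ^ 2}
  set G := {ω | NoiseControl K X β τ q (ε ω).ofLp}
  -- Covering the whole space and using subadditivity avoids any measurability of the events.
  have hcover : Set.univ ⊆ G ∪ ⋃ j, (E₁ j ∪ E₂ j ∪ E₃ j) := by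
    intro ω _
    by_contra hω
    simp only [Set.mem_union, Set.mem_iUnion, not_or, not_exists] at hω
    refine hω.1 ⟨fun j => ?_, fun j => ?_, fun j => ?_⟩
    · have h := (hω.2 j).1.1
      simp only [E₁, Set.mem_ofPred_eq, not_lt] at h
      rw [smoother_transpose, smoother_mul_smoother, trace_smoother] at h
      rwa [show (j : ℕ) + 1 + ((j : ℕ) + 1) = j + j + 1 + 1 by ring]
    · have h := (hω.2 j).1.2
      simp only [E₂, Set.mem_ofPred_eq, not_lt] at h
      rwa [trace_smoother] at h
    · exact le_of_not_gt fun hlt => (hω.2 j).2 hlt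
  have hj : ∀ j, μ.real (E₁ j ∪ E₂ j ∪ E₃ j) ≤ 3 * (δ / (6 * K)) := by
    intro j
    have h1 := (measureReal_mulVec_sq_gt_le hτ hε (smoother X j) q).trans hb
    have h2 := (measureReal_dotProduct_mulVec_gt_le hτ hε (smoother_posSemidef X j) q).trans hb
    have h3 := (measureReal_dotProduct_sq_gt_le hτ hε (smoother X j *ᵥ (X *ᵥ β)) q).trans hb
    have h4 := measureReal_union_le (μ := μ) (E₁ j ∪ E₂ j) (E₃ j)
    have h5 := measureReal_union_le (μ := μ) (E₁ j) (E₂ j)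
    linarith
  have hK' : (0 : ℝ) < K := by exact_mod_cast hK
  have hunion : μ.real (⋃ j, (E₁ j ∪ E₂ j ∪ E₃ j)) ≤ δ := by
    calc _ ≤ ∑ j, μ.real (E₁ j ∪ E₂ j ∪ E₃ j) := measureReal_iUnion_fintype_le _
      _ ≤ ∑ _j : Fin K, 3 * (δ / (6 * K)) := Finset.sum_le_sum fun j _ => hj j
      _ = δ / 2 := by
        rw [Finset.sum_const, Finset.card_univ, Fintype.card_fin, nsmul_eq_mul]
        field_simp
        ring
      _ ≤ δ := by linarith [hδ.1]
  have h1 : (1 : ℝ) ≤ μ.real (G ∪ ⋃ j, (E₁ j ∪ E₂ j ∪ E₃ j)) := by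
    have := measureReal_mono (μ := μ) hcover
    rwa [probReal_univ] at this
  have h2 := measureReal_union_le (μ := μ) G (⋃ j, (E₁ j ∪ E₂ j ∪ E₃ j))
  linarith

/-! ### Risk bound on the noise event -/

theorem ridgeParam_pos (hK : 1 ≤ K) (hδ : δ ∈ Set.Ioo (0 : ℝ) 1) (hn : 0 < n) (hτ : 0 < τ)
    (hR : 0 < rhoMin (corr K X β)) (j : Fin K) : 0 < ridgeParam K X τ δ j := by
  have h1 := rho_designGram_pos hR j
  have h2 := trace_designGram_pow_pos hR j
  have h3 := CDelta_pos hK hδ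
  rw [ridgeParam, cDelta]
  positivity

/-- Deterministic risk bound on the event `NoiseControl`. -/
theorem ridgePLS_risk_le (hK : 1 ≤ K) (hδ : δ ∈ Set.Ioo (0 : ℝ) 1) (hn : 0 < n) (hτ : 0 < τ)
    (hR : 0 < rhoMin (corr K X β)) {e : Fin n → ℝ}
    (he : NoiseControl K X β τ (2 * CDelta K δ) e) :
    1 / n * l2 (X *ᵥ ridgePLS K X (ridgeParam K X τ δ) (X *ᵥ β + e) - X *ᵥ β) ^ 2 ≤
      2 / n * krylovBias K X β
      + 8 * CDelta K δ ^ 2 * (τ ^ 2 / n) * (1 / (K * cDelta K δ) *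
          ∑ i : Fin K, lamBar K X β i * (designGram X ^ ((i : ℕ) + 1)).trace)
      + 4 * CDelta K δ / rhoMin (corr K X β) * (τ ^ 2 / n) *
          ∑ i : Fin K, lamBar K X β i * rho (designGram X) ^ ((i : ℕ) + 1)
      + 5 / 4 * ∑ i : Fin K, ridgeParam K X τ δ i * lam K X β i ^ 2 := by
  have hα := ridgeParam_pos (K := K) hK hδ hn hτ hR
  obtain ⟨θ, hθ, hnormal⟩ := ridge_normal_equation X hα (X *ᵥ β + e)
  have hN : (0 : ℝ) < n := by exact_mod_cast hn
  have hK' : (0 : ℝ) < K := by exact_mod_cast hK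
  have hC := CDelta_pos hK hδ
  rw [fitMatrix_add] at hθ hnormal
  set α := ridgeParam K X τ δ with hαdef
  set C := CDelta K δ with hCdef
  set r := rhoMin (corr K X β) with hr
  have hαval : ∀ j, α j = 16 * C * K * (τ ^ 2 / n) * rho (designGram X) ^ ((j : ℕ) + 1) *
      (designGram X ^ ((j : ℕ) + 1)).trace := fun j => rfl
  -- The 16 in `c_δ` is calibrated here: the noise level `2C` is an eighth of `16C`.
  have hE : ∀ h : Fin K → ℝ, 1 / (n : ℝ) * ((fitMatrix K X e *ᵥ h) ⬝ᵥ (fitMatrix K X e *ᵥ h)) ≤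
      1 / 8 * ∑ j, α j * h j ^ 2 := by
    intro h
    have hj : ∀ j : Fin K, h j ^ 2 * ((fitMatrix K X e).col j ⬝ᵥ (fitMatrix K X e).col j) ≤
        h j ^ 2 * (2 * C * τ ^ 2 * (rho (designGram X) ^ ((j : ℕ) + 1) *
          (designGram X ^ ((j : ℕ) + 1)).trace)) := by
      intro j
      rw [fitMatrix_col]
      refine mul_le_mul_of_nonneg_left ((he.smoothed j).trans ?_) (sq_nonneg _)
      exact mul_le_mul_of_nonneg_left (trace_pow_add_le (designGram_posSemidef X) _ _)
        (by positivity)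
    calc _ ≤ 1 / (n : ℝ) * (K * ∑ j, h j ^ 2 *
          (2 * C * τ ^ 2 * (rho (designGram X) ^ ((j : ℕ) + 1) *
            (designGram X ^ ((j : ℕ) + 1)).trace))) := by
          refine mul_le_mul_of_nonneg_left ((mulVec_dotProduct_self_le _ _).trans ?_)
            (by positivity)
          exact mul_le_mul_of_nonneg_left (Finset.sum_le_sum fun j _ => hj j) hK'.le
      _ = _ := by
          rw [← mul_assoc, Finset.mul_sum, Finset.mul_sum]
          refine Finset.sum_congr rfl fun j _ => ?_
          rw [hαval]
          ring
  have hEe : ∀ h : Fin K → ℝ, 2 / (n : ℝ) * (e ⬝ᵥ fitMatrix K X e *ᵥ h) ≤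
      1 / 2 * ∑ j, α j * h j ^ 2 + 8 * C ^ 2 * (τ ^ 2 / n) * (1 / (K * cDelta K δ) *
          ∑ i : Fin K, lamBar K X β i * (designGram X ^ ((i : ℕ) + 1)).trace) := by
    intro h
    rw [dotProduct_mulVec_eq_sum_col, Finset.mul_sum, Finset.mul_sum, Finset.mul_sum,
      Finset.mul_sum, ← Finset.sum_add_distrib]
    refine Finset.sum_le_sum fun j _ => ?_
    rw [fitMatrix_col]
    have hρ := rho_designGram_pos hR j
    have hT := trace_designGram_pow_pos hR j
    have hΛ := one_le_lamBar_mul hR j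
    have hquad := he.quadratic j
    have hquad0 : 0 ≤ e ⬝ᵥ smoother X j *ᵥ e := by
      simpa using (smoother_posSemidef X j).dotProduct_mulVec_nonneg e
    have hαj := hα j
    set T := (designGram X ^ ((j : ℕ) + 1)).trace
    set b := e ⬝ᵥ smoother X j *ᵥ e
    -- Young with weight `α_j/2` spends exactly the half penalty allowed by `ridge_oracle`.
    have h1 := two_mul_mul_le (x := h j) (b := b / n) (half_pos hαj)
    have h2 : (b / n) ^ 2 / (α j / 2) ≤
        8 * C ^ 2 * (τ ^ 2 / n) * (1 / (K * cDelta K δ) * (lamBar K X β j * T)) := by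
      calc (b / n) ^ 2 / (α j / 2) ≤ (2 * C * τ ^ 2 * T / n) ^ 2 / (α j / 2) := by gcongr
        _ = C / (2 * K) * (τ ^ 2 / n) * T * (1 / rho (designGram X) ^ ((j : ℕ) + 1)) := by
          rw [show α j = 16 * C * K * (τ ^ 2 / n) * rho (designGram X) ^ ((j : ℕ) + 1) * T from
            hαval j]
          field_simp
          ring
        _ ≤ C / (2 * K) * (τ ^ 2 / n) * T * lamBar K X β j := by
          refine mul_le_mul_of_nonneg_left ?_ (by positivity)
          rw [div_le_iff₀ (by positivity)]
          exact hΛ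
        _ = _ := by
          rw [cDelta, ← hCdef]
          field_simp
          ring
    calc 2 / (n : ℝ) * (h j * b) = 2 * (h j * (b / n)) := by ring
      _ ≤ _ := h1
      _ ≤ _ := by linarith
  have hWe : ∀ h : Fin K → ℝ, 2 / (n : ℝ) * (e ⬝ᵥ fitMatrix K X (X *ᵥ β) *ᵥ h) ≤
      1 / 2 * (1 / (n : ℝ) *
        ((fitMatrix K X (X *ᵥ β) *ᵥ h) ⬝ᵥ (fitMatrix K X (X *ᵥ β) *ᵥ h))) +
      4 * C / r * (τ ^ 2 / n) *
          ∑ i : Fin K, lamBar K X β i * rho (designGram X) ^ ((i : ℕ) + 1) := by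
    intro h
    have h0 := rhoMin_corr_mul_le hR h
    have h0' : h ⬝ᵥ popTheta K X β *ᵥ h = _ := dotProduct_krylovGram_mulVec X (X *ᵥ β) h
    rw [h0', ← hr] at h0
    refine le_trans ?_ (add_le_add_left (mul_le_mul_of_nonneg_left h0 (by norm_num)) _)
    rw [dotProduct_mulVec_eq_sum_col, Finset.mul_sum, Finset.mul_sum, Finset.mul_sum,
      Finset.mul_sum, ← Finset.sum_add_distrib]
    refine Finset.sum_le_sum fun j _ => ?_
    rw [fitMatrix_col]
    have hΛ := one_le_lamBar_mul hR j
    have hlin := he.linear j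
    have hθj := popTheta_diag_pos hR j
    have hθe : popTheta K X β j j = 1 / (n : ℝ) * ((smoother X j *ᵥ (X *ᵥ β)) ⬝ᵥ
      (smoother X j *ᵥ (X *ᵥ β))) := krylovGram_diag X (X *ᵥ β) j
    set t := popTheta K X β j j
    set b := e ⬝ᵥ smoother X j *ᵥ (X *ᵥ β)
    have hlin' : b ^ 2 ≤ 2 * C * τ ^ 2 * (n * t) := by
      rw [hθe]
      convert hlin using 1
      field_simp
    -- The weight `r Θ_jj/2` is the share of coordinate `j` in half of `‖W h‖²/n`; `Θ_jj` then
    -- cancels against the variance of the linear form.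
    have h1 := two_mul_mul_le (x := h j) (b := b / n) (a := r * t / 2) (by positivity)
    have h2 : (b / n) ^ 2 / (r * t / 2) ≤
        4 * C / r * (τ ^ 2 / n) * (lamBar K X β j * rho (designGram X) ^ ((j : ℕ) + 1)) := by
      calc (b / n) ^ 2 / (r * t / 2) = b ^ 2 / n ^ 2 / (r * t / 2) := by rw [div_pow]
        _ ≤ (2 * C * τ ^ 2 * (n * t)) / n ^ 2 / (r * t / 2) := by gcongr
        _ = 4 * C / r * (τ ^ 2 / n) * 1 := by
          field_simp
          ring
        _ ≤ _ := mul_le_mul_of_nonneg_left hΛ (by positivity)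
    calc 2 / (n : ℝ) * (h j * b) = 2 * (h j * (b / n)) := by ring
      _ ≤ _ := h1
      _ ≤ _ := by linarith
  have hmain := ridge_oracle hN (fitMatrix K X (X *ᵥ β)) (fitMatrix K X e) (X *ᵥ β) e α θ
    (lam K X β) _ _ hnormal hE hEe hWe fun j => (hα j).le
  have hbias := mul_le_mul_of_nonneg_left (residual_le_krylovBias (K := K) hn hR)
    (show 0 ≤ 2 / (n : ℝ) by positivity)
  rw [l2_sq, hθ]
  linarith

end

end RidgePLS

/-! ### Choice of the constants -/

theorem mainTheorem4 (K : ℕ) (hK : 1 ≤ K) (δ : ℝ) (hδ : δ ∈ Set.Ioo (0 : ℝ) 1)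
    (R : Matrix (Fin K) (Fin K) ℝ) (hR : 0 < rhoMin R) :
    ∃ C₁ C₂ C₃ C₄ : ℝ, 0 < C₁ ∧ 0 < C₂ ∧ 0 < C₃ ∧ 0 < C₄ ∧
      ∀ (n p : ℕ) (X : Matrix (Fin n) (Fin p) ℝ) (β : Fin p → ℝ) (τ : ℝ)
        (Ω : Type*) (_ : MeasurableSpace Ω) (μ : Measure Ω) (ε : Ω → EuclideanSpace ℝ (Fin n)),
        0 < n → K ≤ p → 0 < τ →
        HasLaw ε (multivariateGaussian 0 (τ ^ 2 • (1 : Matrix (Fin n) (Fin n) ℝ))) μ →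
        corr K X β = R →
        1 - δ ≤ μ.real {ω |
          1 / n * l2 (X *ᵥ ridgePLS K X (ridgeParam K X τ δ)
              (response X β (ε ω)) - X *ᵥ β) ^ 2 ≤
            2 / n * krylovBias K X β
            + C₁ * (τ ^ 2 / n) *
              (∑ i : Fin K, √((designGram X ^ (2 * ((i : ℕ) + 1))).trace) *
                |lam K X β i|) ^ 2
            + C₂ * l2 (lamTilde K X β) ^ 2 * (τ ^ 2 / n) *
              ∑ j : Fin K, rho (designGram X) ^ (2 * ((j : ℕ) + 1)) /
                (popCov X β ⬝ᵥ
                  (designGram X ^ (2 * ((j : ℕ) + 1) - 1)) *ᵥ popCov X β)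
            + C₃ * (τ ^ 2 / n) *
              (1 / (K * cDelta K δ) *
                  ∑ i : Fin K, lamBar K X β i * (designGram X ^ ((i : ℕ) + 1)).trace
                + ∑ i : Fin K, lamBar K X β i *
                    rho (designGram X) ^ ((i : ℕ) + 1))
            + C₄ * (τ ^ 2 / n) * K * cDelta K δ *
              ∑ i : Fin K, rho (designGram X) ^ ((i : ℕ) + 1) *
                (designGram X ^ ((i : ℕ) + 1)).trace * lam K X β i ^ 2} := by
  have hC := CDelta_pos hK hδ
  have hK' : (0 : ℝ) < K := by exact_mod_cast hK
  have hc : 0 < cDelta K δ := by rw [cDelta]; positivity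
  -- The first two constants multiply nonnegative terms that are only discarded, so any positive
  -- value serves. The third adds the coefficients of the two remainders, since a single constant
  -- multiplies both sums.
  refine ⟨1, 1, 8 * CDelta K δ ^ 2 + 4 * CDelta K δ / rhoMin R, 5 / 4, one_pos, one_pos,
    by positivity, by norm_num, ?_⟩
  rintro n p X β τ Ω _ μ ε hn - hτ hε rfl
  have hprob : IsProbabilityMeasure μ := hε.isProbabilityMeasure_iff.2 inferInstance
  refine (one_sub_le_measureReal_noiseControl (X := X) (β := β) hK hδ hτ hε).trans
    (measureReal_mono fun ω hω => ?_)
  have hrisk := ridgePLS_risk_le hK hδ hn hτ hR hω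
  have hN : (0 : ℝ) < n := by exact_mod_cast hn
  have hps := designGram_posSemidef X
  have hρ := rho_nonneg hps
  have hT₁ : 0 ≤ τ ^ 2 / n * (∑ i : Fin K, √((designGram X ^ (2 * ((i : ℕ) + 1))).trace) *
      |lam K X β i|) ^ 2 := by positivity
  have hT₂ : 0 ≤ l2 (lamTilde K X β) ^ 2 * (τ ^ 2 / n) *
      ∑ j : Fin K, rho (designGram X) ^ (2 * ((j : ℕ) + 1)) /
        (popCov X β ⬝ᵥ (designGram X ^ (2 * ((j : ℕ) + 1) - 1)) *ᵥ popCov X β) := by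
    refine mul_nonneg (by positivity) (Finset.sum_nonneg fun j _ => div_nonneg (by positivity) ?_)
    simpa using (hps.pow _).dotProduct_mulVec_nonneg (popCov X β)
  have hA : 0 ≤ τ ^ 2 / n * (1 / (K * cDelta K δ) *
      ∑ i : Fin K, lamBar K X β i * (designGram X ^ ((i : ℕ) + 1)).trace) := by
    refine mul_nonneg (by positivity) (mul_nonneg (by positivity)
      (Finset.sum_nonneg fun j _ => mul_nonneg (lamBar_nonneg j) (hps.pow _).trace_nonneg))
  have hB : 0 ≤ τ ^ 2 / n * ∑ i : Fin K, lamBar K X β i * rho (designGram X) ^ ((i : ℕ) + 1) :=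
    mul_nonneg (by positivity)
      (Finset.sum_nonneg fun j _ => mul_nonneg (lamBar_nonneg j) (by positivity))
  have hS : ∑ i : Fin K, ridgeParam K X τ δ i * lam K X β i ^ 2 =
      τ ^ 2 / n * K * cDelta K δ * ∑ i : Fin K, rho (designGram X) ^ ((i : ℕ) + 1) *
        (designGram X ^ ((i : ℕ) + 1)).trace * lam K X β i ^ 2 := by
    rw [Finset.mul_sum]
    refine Finset.sum_congr rfl fun i _ => ?_
    rw [ridgeParam]
    ring
  rw [hS] at hrisk
  -- Cross products created by using the summed constant on both sums; they only enlarge the bound.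
  have hA' : 0 ≤ 4 * CDelta K δ / rhoMin (corr K X β) * _ := mul_nonneg (by positivity) hA
  have hB' : 0 ≤ 8 * CDelta K δ ^ 2 * _ := mul_nonneg (by positivity) hB
  refine hrisk.trans ?_
  linarith
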